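/- Let $L=(v_1,\dots,v_\ell)$ be a finite sequence of letters. A block of $L$ is a non-empty contiguous segment $B=(v_i,\dots,v_j)$, $i\le j$; $\ell(B)=j-i+1$ is its length, $s_2(B)$ is the number of distinct letters that appear at least twice in $B$, and $s(B)$ is the total number of distinct letters that appear in $B$. Write $\log$ for the natural logarithm and $\lfloor x\rfloor$ for the integer part of $x$. Theorem. Let $a>1$ be a real number. (1) There is a constant $C$, depending only on $a$, such that for every integer $n\ge 2$ there is a sequence $L$ of length $\lfloor an\rfloor$ over an alphabet of $n$ letters such that every block $B$ of $L$ satisfies $\frac{s_2(B)}{s(B)}\le \frac{C}{\log n}$. (2) Moreover, there is $n_0=n_0(a)$ such that for every $n>n_0$ this holds with $C=9a\log a$: there is a sequence of length $\lfloor an\rfloor$ over $n$ letters all of whose blocks $B$ satisfy $\frac{s_2(B)}{s(B)}\le\frac{9a\log a}{\log n}$. (3) Consequently, the factor $\log n$ cannot be removed from the Etscheid–Röglin lemma (which says that, for some $c_a>0$ and every $n\ge2$, every sequence of length at least $an$ over $n$ letters has a block $B$ with $\frac{s_2(B)}{\ell(B)}\ge\frac{c_a}{\log n}$): for every $c>0$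 and all sufficiently large $n$ (depending on $a$ and $c$) there is a sequence of length $\lfloor an\rfloor$ over $n$ letters all of whose blocks $B$ satisfy $\frac{s_2(B)}{\ell(B)}<c$. -/

import Mathlib

/-! Words are finite sequences `L : Fin ℓ → α`; for `i ≤ j` the block `L[i,j]` is the contiguous
segment of `L` at the positions `i, i + 1, …, j` (both ends included). -/

namespace SparseWord

variable {ℓ : ℕ} {α : Type*} [Fintype α] [DecidableEq α]

/-- The number of occurrences of the letter `v` in the block `L[i,j]`. -/
def occ (L : Fin ℓ → α) (i j : Fin ℓ) (v : α) : ℕ :=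
  ((Finset.Icc i j).filter (fun t => L t = v)).card

/-- The number of singletons of the block `L[i,j]`: letters that appear exactly once in it. -/
def s₁ (L : Fin ℓ → α) (i j : Fin ℓ) : ℕ :=
  (Finset.univ.filter (fun v : α => occ L i j v = 1)).card

/-- The number of repeated letters of the block `L[i,j]`: distinct letters that appear at least
twice in it. -/
def s₂ (L : Fin ℓ → α) (i j : Fin ℓ) : ℕ :=
  (Finset.univ.filter (fun v : α => 2 ≤ occ L i j v)).card

/-- The number of distinct letters of the block `L[i,j]`. -/
def s (L : Fin ℓ → α) (i j : Fin ℓ) : ℕ := s₁ L i j + s₂ L i j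

/-- The length `j - i + 1` of the block `L[i,j]` (meaningful for `i ≤ j`). -/
def blockLength (i j : Fin ℓ) : ℕ := (j : ℕ) - (i : ℕ) + 1

end SparseWord

namespace SparseWord

section Counting

variable {ℓ : ℕ} {α : Type*} [Fintype α] [DecidableEq α]

/-! Cut the word into windows of length `K + D`: slot `r < K` cycles through the codes in `[2^r,
2^(r+1))`, and the other `D` slots carry fresh letters. A cyclic letter recurs only after a multiple
of `2^r` windows, so a letter repeated in a block of length `m` has code at most `2m/(K+D)`
(`s₂_mul_le`), while the fresh slots give at least `⌊m/(K+D)⌋ * D` distinct letters (`mul_le_s`).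
Hence `s₂/s ≤ 4/D`. The alphabet needs about `2^K + a n D/(K+D)` letters, so `K` and `D` can both be
of order `log n` (`exists_parameters`). -/

theorem s_eq_card_image (L : Fin ℓ → α) (i j : Fin ℓ) :
    s L i j = ((Finset.Icc i j).image L).card := by
  unfold s s₁ s₂
  rw [← Finset.card_union_of_disjoint]
  · congr 1
    ext v
    have h : v ∈ (Finset.Icc i j).image L ↔ 0 < occ L i j v := by
      unfold occ
      rw [Finset.card_pos, Finset.filter_nonempty_iff, Finset.mem_image]
    rw [h]
    simp only [Finset.mem_union, Finset.mem_filter, Finset.mem_univ, true_and]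
    omega
  · rw [Finset.disjoint_filter]
    intro v _ h
    omega

theorem s₂_le_s (L : Fin ℓ → α) (i j : Fin ℓ) : s₂ L i j ≤ s L i j :=
  Nat.le_add_left _ _

theorem s_le_blockLength (L : Fin ℓ → α) {i j : Fin ℓ} (hij : i ≤ j) :
    s L i j ≤ blockLength i j := by
  rw [s_eq_card_image]
  refine Finset.card_image_le.trans ?_
  rw [Fin.card_Icc, blockLength]
  have : (i : ℕ) ≤ j := hij
  omega

end Counting

theorem exists_lt_of_two_le_occ {ℓ : ℕ} {α : Type*} [DecidableEq α] {L : Fin ℓ → α}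
    {i j : Fin ℓ} {v : α} (h : 2 ≤ occ L i j v) :
    ∃ t t' : Fin ℓ, i ≤ t ∧ t < t' ∧ t' ≤ j ∧ L t = v ∧ L t' = v := by
  obtain ⟨x, hx, y, hy, hxy⟩ := Finset.one_lt_card.mp (show 1 < _ from h)
  simp only [Finset.mem_filter, Finset.mem_Icc] at hx hy
  rcases lt_or_gt_of_ne hxy with hlt | hlt
  · exact ⟨x, y, hx.1.1, hlt, hy.1.2, hx.2, hy.2⟩
  · exact ⟨y, x, hy.1.1, hlt, hx.1.2, hy.2, hx.2⟩

/-- The letter at position `t` of the sparse word with parameters `K` and `D`. Each window of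
length `K + D` starts with one letter from each of `K` cyclic alphabets of sizes `2 ^ 0, 2 ^ 1, …`,
followed by `D` letters that are used nowhere else. -/
def letter (K D t : ℕ) : ℕ :=
  if t % (K + D) < K then 2 ^ (t % (K + D)) + t / (K + D) % 2 ^ (t % (K + D))
  else 2 ^ K + (t / (K + D) * D + (t % (K + D) - K))

/-! ### Arithmetic of the letter codes -/

theorem cyclic_letter_lt (r q : ℕ) : 2 ^ r + q % 2 ^ r < 2 ^ (r + 1) := by
  have := Nat.mod_lt q (Nat.two_pow_pos r)
  rw [pow_succ]
  omega

theorem letter_lt_two_pow {K D t : ℕ} (h : t % (K + D) < K) : letter K D t < 2 ^ K := by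
  rw [letter, if_pos h]
  exact (cyclic_letter_lt _ _).trans_le (Nat.pow_le_pow_right two_pos h)

theorem two_pow_le_letter {K D t : ℕ} (h : K ≤ t % (K + D)) : 2 ^ K ≤ letter K D t := by
  rw [letter, if_neg h.not_gt]
  exact Nat.le_add_right _ _

theorem letter_lt {K D N t : ℕ} (hD : 0 < D) (ht : t < N) :
    letter K D t < 2 ^ K + (N / (K + D) + 1) * D := by
  by_cases h : t % (K + D) < K
  · exact (letter_lt_two_pow h).trans_le (Nat.le_add_right _ _)
  · rw [letter, if_neg h]
    have h1 : t % (K + D) < K + D := Nat.mod_lt _ (by omega)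
    have h2 : t / (K + D) * D ≤ N / (K + D) * D :=
      Nat.mul_le_mul_right _ (Nat.div_le_div_right ht.le)
    rw [add_mul, one_mul]
    omega

theorem letter_inj_of_le_mod {K D t t' : ℕ} (hD : 0 < D) (h : K ≤ t % (K + D))
    (h' : K ≤ t' % (K + D)) (e : letter K D t = letter K D t') : t = t' := by
  rw [letter, letter, if_neg h.not_gt, if_neg h'.not_gt] at e
  have h1 : t % (K + D) < K + D := Nat.mod_lt _ (by omega)
  have h2 : t' % (K + D) < K + D := Nat.mod_lt _ (by omega)
  have e' := Nat.add_left_cancel e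
  have eq : t / (K + D) = t' / (K + D) := by
    have := congrArg (· / D) e'
    simp only [mul_comm _ D] at this
    rwa [Nat.mul_add_div hD, Nat.mul_add_div hD, Nat.div_eq_of_lt (a := t % (K + D) - K) (by omega),
      Nat.div_eq_of_lt (a := t' % (K + D) - K) (by omega)] at this
  have er : t % (K + D) = t' % (K + D) := by
    rw [eq] at e'
    omega
  rw [← Nat.div_add_mod t (K + D), ← Nat.div_add_mod t' (K + D), eq, er]

/-- Equal letters at distinct positions are cyclic ones, and they are far apart. -/
theorem gap_of_letter_eq {K D t t' : ℕ} (hD : 0 < D) (hlt : t < t')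
    (e : letter K D t = letter K D t') :
    ∃ r, 2 ^ r ≤ letter K D t ∧ letter K D t < 2 ^ (r + 1) ∧ (K + D) * 2 ^ r ≤ t' - t := by
  by_cases h : t % (K + D) < K <;> by_cases h' : t' % (K + D) < K
  · have b := cyclic_letter_lt (t % (K + D)) (t / (K + D))
    have b' := cyclic_letter_lt (t' % (K + D)) (t' / (K + D))
    have l : letter K D t = _ := if_pos h
    have l' : letter K D t' = _ := if_pos h'
    rw [l, l'] at e
    -- The dyadic intervals `[2^r, 2^(r+1))` are disjoint, so the code determines its slot.
    have er : t % (K + D) = t' % (K + D) := by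
      have h1 : t % (K + D) < t' % (K + D) + 1 :=
        (Nat.pow_lt_pow_iff_right one_lt_two).mp (by omega)
      have h2 : t' % (K + D) < t % (K + D) + 1 :=
        (Nat.pow_lt_pow_iff_right one_lt_two).mp (by omega)
      omega
    refine ⟨t % (K + D), by rw [l]; exact Nat.le_add_right _ _, by rw [l]; exact b, ?_⟩
    rw [← er] at e
    have eq : t / (K + D) ≡ t' / (K + D) [MOD 2 ^ (t % (K + D))] := Nat.add_left_cancel e
    have hle : t / (K + D) ≤ t' / (K + D) := Nat.div_le_div_right hlt.le
    have dt := Nat.div_add_mod t (K + D)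
    have dt' := Nat.div_add_mod t' (K + D)
    have hsub : t' - t = (K + D) * (t' / (K + D) - t / (K + D)) := by
      rw [Nat.mul_sub]
      omega
    rw [hsub]
    refine Nat.mul_le_mul_left _ (Nat.le_of_dvd ?_ ((Nat.modEq_iff_dvd' hle).mp eq))
    by_contra h0
    rw [Nat.eq_zero_of_not_pos h0] at hsub
    omega
  · have := letter_lt_two_pow h
    have := two_pow_le_letter (not_lt.mp h')
    omega
  · have := letter_lt_two_pow h'
    have := two_pow_le_letter (not_lt.mp h)
    omega
  · exact absurd (letter_inj_of_le_mod hD (not_lt.mp h) (not_lt.mp h') e) hlt.ne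

theorem card_filter_le_mod (K D i p : ℕ) :
    ((Finset.Ico i (i + p * (K + D))).filter (fun t => K ≤ t % (K + D))).card = p * D := by
  induction p with
  | zero => simp
  | succ p ih =>
    have hcount : Nat.count (fun t => K ≤ t % (K + D)) (K + D) = D := by
      rw [Nat.count_eq_card_filter_range]
      have : (Finset.range (K + D)).filter (fun t => K ≤ t % (K + D)) = Finset.Ico K (K + D) := by
        ext t
        simp only [Finset.mem_filter, Finset.mem_range, Finset.mem_Ico]
        constructor
        · rintro ⟨h1, h2⟩
          rw [Nat.mod_eq_of_lt h1] at h2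
          exact ⟨h2, h1⟩
        · rintro ⟨h1, h2⟩
          rw [Nat.mod_eq_of_lt h2]
          exact ⟨h2, h1⟩
      rw [this, Nat.card_Ico]
      omega
    have hper : Function.Periodic (fun t => K ≤ t % (K + D)) (K + D) := fun t => by
      simp only [Nat.add_mod_right]
    have hlast := Nat.filter_Ico_card_eq_of_periodic (i + p * (K + D)) (K + D)
      (fun t => K ≤ t % (K + D)) hper
    rw [hcount] at hlast
    have hsplit : Finset.Ico i (i + (p + 1) * (K + D)) =
        Finset.Ico i (i + p * (K + D)) ∪
          Finset.Ico (i + p * (K + D)) (i + p * (K + D) + (K + D)) := by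
      rw [Finset.Ico_union_Ico_eq_Ico (by omega) (by omega), add_mul, one_mul, add_assoc]
    rw [hsplit, Finset.filter_union, Finset.card_union_of_disjoint, ih, hlast, add_mul, one_mul]
    exact Finset.disjoint_filter_filter (Finset.Ico_disjoint_Ico_consecutive _ _ _)

/-! ### Repeated and distinct letters in a block -/

section Word

variable {K D N n : ℕ} {L : Fin N → Fin n}

theorem s₂_mul_le (hD : 0 < D) (hL : ∀ t, (L t : ℕ) = letter K D t) (i j : Fin N) :
    s₂ L i j * (K + D) ≤ 2 * blockLength i j := by
  suffices h : s₂ L i j ≤ 2 * blockLength i j / (K + D) from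
    (Nat.mul_le_mul_right _ h).trans (Nat.div_mul_le_self _ _)
  -- Codes of repeated letters start at `1`, so it suffices to bound the largest of them.
  rw [s₂, ← Nat.add_sub_cancel (n := 2 * blockLength i j / (K + D)) (m := 1), ← Nat.card_Icc,
    ← Finset.card_map Fin.valEmbedding]
  refine Finset.card_le_card fun v hv => ?_
  obtain ⟨w, hw, rfl⟩ := Finset.mem_map.mp hv
  obtain ⟨t, t', hit, htt, htj, e, e'⟩ := exists_lt_of_two_le_occ (Finset.mem_filter.mp hw).2
  have hw1 : (w : ℕ) = letter K D t := by rw [← e, hL]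
  have hw2 : (w : ℕ) = letter K D t' := by rw [← e', hL]
  obtain ⟨r, h1, h2, h3⟩ := gap_of_letter_eq hD htt (hw1.symm.trans hw2)
  rw [← hw1] at h1 h2
  have := Nat.two_pow_pos r
  have hit' : (i : ℕ) ≤ t := hit
  have htj' : (t' : ℕ) ≤ j := htj
  rw [Fin.valEmbedding_apply, Finset.mem_Icc, Nat.le_div_iff_mul_le (by omega), blockLength]
  refine ⟨by omega, ?_⟩
  calc (w : ℕ) * (K + D) ≤ 2 ^ (r + 1) * (K + D) := Nat.mul_le_mul_right _ h2.le
    _ = 2 * ((K + D) * 2 ^ r) := by ring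
    _ ≤ _ := by omega

theorem s₂_eq_zero (hD : 0 < D) (hL : ∀ t, (L t : ℕ) = letter K D t) {i j : Fin N}
    (h : blockLength i j < K + D) : s₂ L i j = 0 := by
  rw [s₂, Finset.card_eq_zero, Finset.filter_eq_empty_iff]
  intro w _ hw
  obtain ⟨t, t', hit, htt, htj, e, e'⟩ := exists_lt_of_two_le_occ hw
  obtain ⟨r, -, -, h3⟩ := gap_of_letter_eq (K := K) hD htt (by rw [← hL, ← hL, e, e'])
  have := Nat.le_mul_of_pos_right (K + D) (Nat.two_pow_pos r)
  have hit' : (i : ℕ) ≤ t := hit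
  have htj' : (t' : ℕ) ≤ j := htj
  rw [blockLength] at h
  omega

theorem mul_le_s (hD : 0 < D) (hL : ∀ t, (L t : ℕ) = letter K D t) {i j : Fin N} (hij : i ≤ j) :
    blockLength i j / (K + D) * D ≤ s L i j := by
  rw [s_eq_card_image, ← card_filter_le_mod K D i, ← Finset.card_map Fin.valEmbedding]
  refine Finset.card_le_card_of_injOn (letter K D) (fun t ht => ?_) fun t ht t' ht' e => ?_
  · have ht := Finset.mem_filter.mp ht
    rw [Finset.mem_Ico] at ht
    have hle := Nat.div_mul_le_self (blockLength i j) (K + D)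
    have hij' : (i : ℕ) ≤ j := hij
    have htj : t ≤ j := by
      have : blockLength i j = j - i + 1 := rfl
      omega
    have htN : t < N := htj.trans_lt j.isLt
    refine Finset.mem_coe.mpr (Finset.mem_map.mpr ⟨L ⟨t, htN⟩, ?_, hL _⟩)
    exact Finset.mem_image_of_mem _ (Finset.mem_Icc.mpr ⟨ht.1.1, htj⟩)
  · exact letter_inj_of_le_mod hD (Finset.mem_filter.mp ht).2 (Finset.mem_filter.mp ht').2 e

/-- A block shorter than a window has no repeats; otherwise rounding its length down to whole
windows loses less than a factor 2, which turns the 2 of `s₂_mul_le` into 4. -/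
theorem s₂_mul_le_four_mul_s (hD : 0 < D) (hL : ∀ t, (L t : ℕ) = letter K D t) {i j : Fin N}
    (hij : i ≤ j) : s₂ L i j * D ≤ 4 * s L i j := by
  rcases lt_or_ge (blockLength i j) (K + D) with h | h
  · simp [s₂_eq_zero hD hL h]
  · have hp : 1 ≤ blockLength i j / (K + D) := (Nat.one_le_div_iff (by omega)).mpr h
    have hlt : blockLength i j < (K + D) * (blockLength i j / (K + D) + 1) :=
      Nat.lt_mul_div_succ _ (by omega)
    have h2 := s₂_mul_le hD hL i j
    have hs := mul_le_s hD hL hij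
    generalize blockLength i j / (K + D) = p at *
    have h4 : s₂ L i j ≤ 4 * p := by
      refine Nat.le_of_mul_le_mul_right (c := K + D) ?_ (by omega)
      nlinarith
    calc s₂ L i j * D ≤ 4 * p * D := Nat.mul_le_mul_right _ h4
      _ = 4 * (p * D) := by ring
      _ ≤ _ := by omega

end Word

/-- A word of length `N` over `n` letters whose blocks have ratio `s₂ / s` at most `4 / D`. -/
theorem exists_word {K D N n : ℕ} (hD : 0 < D) (h : 2 ^ K + (N / (K + D) + 1) * D ≤ n) :
    ∃ L : Fin N → Fin n, ∀ i j : Fin N, i ≤ j → (s₂ L i j : ℝ) / s L i j ≤ 4 / D := by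
  refine ⟨fun t => ⟨letter K D t, (letter_lt hD t.isLt).trans_le h⟩, fun i j hij => ?_⟩
  have key := s₂_mul_le_four_mul_s hD (K := K)
    (L := fun t => ⟨letter K D t, (letter_lt hD t.isLt).trans_le h⟩) (fun _ => rfl) hij
  rcases Nat.eq_zero_or_pos (s (fun t : Fin N => (⟨letter K D t,
    (letter_lt hD t.isLt).trans_le h⟩ : Fin n)) i j) with h0 | h0
  · rw [h0, Nat.cast_zero, div_zero]
    positivity
  · rw [div_le_div_iff₀ (by exact_mod_cast h0) (by exact_mod_cast hD)]
    exact_mod_cast key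

/-! ### Choice of the parameters -/

theorem sub_one_le_mul_log {a : ℝ} (ha : 0 < a) : a - 1 ≤ a * Real.log a := by
  have h := Real.one_sub_inv_le_log_of_pos ha
  have := mul_le_mul_of_nonneg_left h ha.le
  rwa [mul_sub, mul_inv_cancel₀ ha.ne', mul_one] at this

/-- Admissible parameters for all large alphabets. -/
theorem exists_parameters {a : ℝ} (ha : 1 < a) :
    ∃ n₀ : ℕ, ∀ n : ℕ, n₀ < n → ∃ K D : ℕ, 0 < D ∧
      2 ^ K + (⌊a * (n : ℝ)⌋₊ / (K + D) + 1) * D ≤ n ∧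
      (4 : ℝ) / D ≤ 9 * a * Real.log a / Real.log n := by
  have ha' : 0 < a - 1 := sub_pos.mpr ha
  -- With `D ≈ βK`, the fresh letters fit when `β(a - 1) < 1`; the value `4/5` leaves a fixed
  -- fraction of `n` for `2^K + D`.
  set β : ℝ := 4 / (5 * (a - 1)) with hβ
  have hβ0 : 0 < β := by positivity
  have hβa : β * (a - 1) = 4 / 5 := by
    rw [hβ]
    field_simp
  -- The three thresholds serve, in order, the fit of `2^K + D`, the positivity of `D`, and the
  -- final logarithmic estimate.
  obtain ⟨K₀, hK₀⟩ := exists_nat_gt (max (5 * (1 + β) ^ 2) (max (2 / β) (6 * (a - 1) + 4)))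
  simp only [max_lt_iff] at hK₀
  obtain ⟨hA, hB, hC⟩ := hK₀
  refine ⟨4 ^ K₀, fun n hn => ?_⟩
  have hn0 : n ≠ 0 := ((Nat.zero_le _).trans_lt hn).ne'
  -- Base 4 keeps `2^K ≤ √n`.
  set K := Nat.log 4 n with hK
  have hK0 : K₀ ≤ K := Nat.le_log_of_pow_le (by norm_num) hn.le
  have hK0' : (K₀ : ℝ) ≤ K := by exact_mod_cast hK0
  have hn4 : (4 : ℝ) ^ K ≤ n := by exact_mod_cast Nat.pow_log_le_self 4 hn0
  have hn4' : (n : ℝ) < 4 ^ (K + 1) := by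
    exact_mod_cast Nat.lt_pow_succ_log_self (by norm_num) n
  have hK2 : (K : ℝ) ≤ 2 ^ K := by exact_mod_cast Nat.lt_two_pow_self.le
  have hKpos : (0 : ℝ) < K := by linarith
  have hβK : 2 < β * K := by
    have := (div_lt_iff₀ hβ0).mp (hB.trans_le hK0')
    linarith
  have hDle : (⌊β * K⌋₊ : ℝ) ≤ β * K := Nat.floor_le (by positivity)
  have hDgt : β * K < ⌊β * K⌋₊ + 1 := Nat.lt_floor_add_one _
  generalize ⌊β * K⌋₊ = D at hDle hDgt
  have hDpos : (0 : ℝ) < D := by linarith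
  have hn1 : (1 : ℝ) < n := by
    have : 1 < n := lt_of_le_of_lt Nat.one_le_two_pow (by
      calc 2 ^ K₀ ≤ 4 ^ K₀ := Nat.pow_le_pow_left (by norm_num) _
        _ < n := hn)
    exact_mod_cast this
  refine ⟨K, D, by exact_mod_cast hDpos, ?_, ?_⟩
  · have hfl : (⌊a * (n : ℝ)⌋₊ : ℝ) ≤ a * n := Nat.floor_le (by positivity)
    have hdiv : ((⌊a * (n : ℝ)⌋₊ / (K + D) : ℕ) : ℝ) ≤ a * n / (K + D) := by
      refine Nat.cast_div_le.trans ?_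
      push_cast
      gcongr
    have haD : (a - 1) * D ≤ 4 / 5 * K := by
      calc (a - 1) * D ≤ (a - 1) * (β * K) := by gcongr
        _ = β * (a - 1) * K := by ring
        _ = 4 / 5 * K := by rw [hβa]
    have hmain : a * n / (K + D) * D ≤ n - n / (5 * (1 + β)) := by
      have h1 : a * n / (K + D) * D = n - n * ((K - (a - 1) * D) / (K + D)) := by
        field_simp
        ring
      have h2 : 1 / (5 * (1 + β)) ≤ (K - (a - 1) * D) / (K + D) := by
        rw [div_le_div_iff₀ (by positivity) (by positivity)]
        nlinarith
      have h3 : (n : ℝ) * (1 / (5 * (1 + β))) ≤ n * ((K - (a - 1) * D) / (K + D)) := by gcongr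
      rw [h1]
      rw [mul_one_div] at h3
      linarith
    have hrest : (2 : ℝ) ^ K + D ≤ n / (5 * (1 + β)) := by
      rw [le_div_iff₀ (by positivity)]
      have h1 : (2 : ℝ) ^ K + D ≤ (1 + β) * 2 ^ K := by nlinarith
      have h4 : (4 : ℝ) ^ K = 2 ^ K * 2 ^ K := by
        rw [← mul_pow]
        norm_num
      calc ((2 : ℝ) ^ K + D) * (5 * (1 + β)) ≤ (1 + β) * 2 ^ K * (5 * (1 + β)) := by gcongr
        _ = 2 ^ K * (5 * (1 + β) ^ 2) := by ring
        _ ≤ 2 ^ K * 2 ^ K := by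
          gcongr
          linarith
        _ ≤ n := by rwa [← h4]
    have : (2 : ℝ) ^ K + (((⌊a * (n : ℝ)⌋₊ / (K + D) : ℕ) : ℝ) + 1) * D ≤ n := by
      have := mul_le_mul_of_nonneg_right hdiv hDpos.le
      linarith
    exact_mod_cast this
  · have hlogn : 0 < Real.log n := Real.log_pos hn1
    -- `7/5` is a rational bound for `log 4`; then `4 * 7/5 = 5.6` stays below `9 * 4/5 = 7.2`.
    have hlog : Real.log n ≤ (K + 1) * (7 / 5) := by
      have h1 : Real.log n ≤ Real.log (4 ^ (K + 1)) :=
        Real.log_le_log (by linarith) hn4'.le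
      have h2 : Real.log 4 = 2 * Real.log 2 := by
        rw [show (4 : ℝ) = 2 ^ 2 by norm_num, Real.log_pow]
        norm_num
      rw [Real.log_pow, h2] at h1
      push_cast at h1
      have := Real.log_two_lt_d9
      nlinarith
    rw [div_le_div_iff₀ hDpos hlogn]
    have hal := sub_one_le_mul_log (zero_lt_one.trans ha)
    have h1 : (a - 1) * (β * K) ≤ (a - 1) * (D + 1) := by gcongr
    have h2 : (a - 1) * (β * K) = 4 / 5 * K := by rw [← hβa]; ring
    calc 4 * Real.log n ≤ 9 * (a - 1) * D := by linarith
      _ ≤ 9 * (a * Real.log a) * D := by gcongr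
      _ = _ := by ring

theorem exists_word_of_large {a : ℝ} (ha : 1 < a) :
    ∃ n₀ : ℕ, ∀ n : ℕ, n₀ < n →
      ∃ L : Fin ⌊a * (n : ℝ)⌋₊ → Fin n, ∀ i j : Fin ⌊a * (n : ℝ)⌋₊, i ≤ j →
        (s₂ L i j : ℝ) / (s L i j : ℝ) ≤ (9 * a * Real.log a) / Real.log (n : ℝ) := by
  obtain ⟨n₀, h⟩ := exists_parameters ha
  refine ⟨n₀, fun n hn => ?_⟩
  obtain ⟨K, D, hD, hlen, hratio⟩ := h n hn
  obtain ⟨L, hL⟩ := exists_word hD hlen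
  exact ⟨L, fun i j hij => (hL i j hij).trans hratio⟩

theorem s₂_div_blockLength_le {ℓ : ℕ} {α : Type*} [Fintype α] [DecidableEq α] (L : Fin ℓ → α)
    {i j : Fin ℓ} (hij : i ≤ j) :
    (s₂ L i j : ℝ) / blockLength i j ≤ (s₂ L i j : ℝ) / s L i j := by
  have hpos : 0 < s L i j := by
    rw [s_eq_card_image, Finset.card_pos]
    exact (Finset.nonempty_Icc.mpr hij).image L
  gcongr
  exact s_le_blockLength L hij

end SparseWord

theorem theoremT (a : ℝ) (ha : 1 < a) :
    -- a constant depending only on `a` that works for every alphabet size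
    (∃ C : ℝ, ∀ n : ℕ, 2 ≤ n →
      ∃ L : Fin ⌊a * (n : ℝ)⌋₊ → Fin n, ∀ i j : Fin ⌊a * (n : ℝ)⌋₊, i ≤ j →
        (SparseWord.s₂ L i j : ℝ) / (SparseWord.s L i j : ℝ) ≤ C / Real.log (n : ℝ)) ∧
    -- the explicit constant for all large alphabet sizes
    (∃ n₀ : ℕ, ∀ n : ℕ, n₀ < n →
      ∃ L : Fin ⌊a * (n : ℝ)⌋₊ → Fin n, ∀ i j : Fin ⌊a * (n : ℝ)⌋₊, i ≤ j →
        (SparseWord.s₂ L i j : ℝ) / (SparseWord.s L i j : ℝ)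
          ≤ (9 * a * Real.log a) / Real.log (n : ℝ)) ∧
    -- no positive lower bound, independent of `n`, on the best ratio `s₂(B) / ℓ(B)`
    (∀ c : ℝ, 0 < c → ∃ n₁ : ℕ, ∀ n : ℕ, n₁ < n →
      ∃ L : Fin ⌊a * (n : ℝ)⌋₊ → Fin n, ∀ i j : Fin ⌊a * (n : ℝ)⌋₊, i ≤ j →
        (SparseWord.s₂ L i j : ℝ) / (SparseWord.blockLength i j : ℝ) < c) := by
  obtain ⟨n₀, hn₀⟩ := SparseWord.exists_word_of_large ha
  -- For `n ≤ n₀` the trivial ratio bound 1 is enough once `C ≥ log n₀`, so any word serves.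
  refine ⟨⟨max (9 * a * Real.log a) (Real.log n₀), fun n hn => ?_⟩, ⟨n₀, hn₀⟩, fun c hc => ?_⟩
  · have hlog : 0 < Real.log n := Real.log_pos (by exact_mod_cast hn)
    rcases lt_or_ge n₀ n with h | h
    · obtain ⟨L, hL⟩ := hn₀ n h
      refine ⟨L, fun i j hij => (hL i j hij).trans ?_⟩
      gcongr
      exact le_max_left _ _
    · refine ⟨fun _ => ⟨0, by omega⟩, fun i j _ => ?_⟩
      have hle : Real.log n ≤ Real.log n₀ :=
        Real.log_le_log (by exact_mod_cast (by omega : 0 < n)) (by exact_mod_cast h)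
      calc _ ≤ (1 : ℝ) := div_le_one_of_le₀ (by exact_mod_cast SparseWord.s₂_le_s _ i j)
            (Nat.cast_nonneg _)
        _ ≤ _ := (one_le_div hlog).mpr (hle.trans (le_max_right _ _))
  · have hlim : Filter.Tendsto (fun n : ℕ => 9 * a * Real.log a / Real.log n)
        Filter.atTop (nhds 0) :=
      (Real.tendsto_log_atTop.comp tendsto_natCast_atTop_atTop).const_div_atTop _
    obtain ⟨n₂, hn₂⟩ := Filter.eventually_atTop.mp (hlim.eventually_lt_const hc)
    refine ⟨max n₀ n₂, fun n hn => ?_⟩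
    obtain ⟨L, hL⟩ := hn₀ n ((le_max_left _ _).trans_lt hn)
    exact ⟨L, fun i j hij => ((SparseWord.s₂_div_blockLength_le L hij).trans
      (hL i j hij)).trans_lt (hn₂ n ((le_max_right _ _).trans hn.le))⟩
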